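/- Let $\beta>0$, $h>0$, $p\in[0,1]$ and $k>0$ be real numbers. The fluid model of the Tangle under a Tips Inflation Attack, with constant arrival rate $\beta$, delay $h$, honest fraction $p$ and $k$ parents per block, is the delay-differential system $$\dot x(t)=\beta-p\beta\,u(t),\qquad \dot l(t)=\beta-p\beta\,u(t-h),\qquad w(t)=l(t)-x(t)=\int_{t-h}^{t}p\beta\,u(s)\,ds,\qquad u(t)=\frac{k\,x(t)}{l(t)},$$ with continuous initial conditions on $[-h,0]$ satisfying $w=l-x$; the differential equations are required for $t>0$, the integral relation for $t\ge 0$, and $l$ must not vanish. Suppose $pk>1$. Then the system has exactly one constant solution, $$\hat x=\frac{h\beta}{pk-1},\qquad \hat l=\frac{pkh}{pk-1}\beta,\qquad \hat w=\frac{pkh-h}{pk-1}\beta,$$ its components are positive, and it is locally stable, in the following senses. (i) Every solution $(\zeta,\theta,\eta)$ of the system linearised at $(\hat x,\hat l,\hat w)$ (all of its equations, including the integral relation, being linearised) satisfies $\max\{|\zeta(t)|,|\theta(t)|,|\eta(t)|\}\to 0$ as $t\to\infty$. (ii) The spectrum of the linearised system, that is, the set of $z\in\mathbb C$ for which it has a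 nonzero solution $e^{zt}(\zeta,\theta,\eta)$ with constant $\zeta,\theta,\eta\in\mathbb C$, is the set of roots of $$c+\frac{c}{c-1}\,hz=e^{-hz},\qquad c=pk,$$ and every such root has $\operatorname{Re}z<0$. (iii) The constant solution is locally asymptotically stable for the nonlinear system. For every $\varepsilon>0$ there is $\delta>0$ such that a solution whose components are within $\delta$ of $(\hat x,\hat l,\hat w)$ on $[-h,0]$ stays within $\varepsilon$ of it for as long as it exists. Moreover there is $\delta>0$ such that every solution defined for all $t\ge0$ whose components are within $\delta$ of $(\hat x,\hat l,\hat w)$ on $[-h,0]$ converges to $(\hat x,\hat l,\hat w)$ as $t\to\infty$. -/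

import Mathlib

open Set Filter Topology

noncomputable section

/-- The expected number `u = k x / l` of free tips selected by a new honest block. -/
def selectionRate (k x l : ℝ) : ℝ := k * x / l

/-- `(x, l, w)` solves, on `[-h, T]`, the fluid model of the Tangle with `k` parents per block under
a Tips Inflation Attack, with arrival rate `a`, delay `h` and honest fraction `p`.  The values on
`[-h, 0]` are the (continuous) initial conditions; the delay equations hold for `0 < t < T` and the
integral relation for the pending tips on `[0, T]`, where all the delayed values are available. -/
structure IsTangleSolutionOn (a : ℝ → ℝ) (h p k T : ℝ) (x l w : ℝ → ℝ) : Prop where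
  continuousOn_x : ContinuousOn x (Icc (-h) T)
  continuousOn_l : ContinuousOn l (Icc (-h) T)
  l_ne_zero : ∀ t ∈ Icc (-h) T, l t ≠ 0
  deriv_x : ∀ t ∈ Ioo 0 T,
    HasDerivAt x (a (t - h) - p * a t * selectionRate k (x t) (l t)) t
  deriv_l : ∀ t ∈ Ioo 0 T,
    HasDerivAt l (a (t - h) - p * a (t - h) * selectionRate k (x (t - h)) (l (t - h))) t
  w_eq_sub : ∀ t ∈ Icc (-h) T, w t = l t - x t
  w_eq_integral : ∀ t ∈ Icc 0 T,
    w t = ∫ s in (t - h)..t, p * a s * selectionRate k (x s) (l s)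

/-- A solution on `[-h, ∞)`. -/
def IsTangleSolution (a : ℝ → ℝ) (h p k : ℝ) (x l w : ℝ → ℝ) : Prop :=
  ∀ T > 0, IsTangleSolutionOn a h p k T x l w

/-- On the initial interval `[-h, 0]` all three components are within `δ` of `(x₀, l₀, w₀)`. -/
def InitiallyClose (h δ x₀ l₀ w₀ : ℝ) (x l w : ℝ → ℝ) : Prop :=
  ∀ t ∈ Icc (-h) 0, |x t - x₀| < δ ∧ |l t - l₀| < δ ∧ |w t - w₀| < δ

/-- Local asymptotic stability (in the sense of Lyapunov) of the constant solution `(x₀, l₀, w₀)` of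
the nonlinear system.  The first field bounds every solution as long as it exists. -/
structure IsLocallyAsymptoticallyStable (a : ℝ → ℝ) (h p k x₀ l₀ w₀ : ℝ) : Prop where
  stable : ∀ ε > 0, ∃ δ > 0, ∀ T > 0, ∀ x l w : ℝ → ℝ,
    IsTangleSolutionOn a h p k T x l w → InitiallyClose h δ x₀ l₀ w₀ x l w →
      ∀ t ∈ Icc 0 T, |x t - x₀| < ε ∧ |l t - l₀| < ε ∧ |w t - w₀| < ε
  attractive : ∃ δ > 0, ∀ x l w : ℝ → ℝ,
    IsTangleSolution a h p k x l w → InitiallyClose h δ x₀ l₀ w₀ x l w →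
      Tendsto x atTop (𝓝 x₀) ∧ Tendsto l atTop (𝓝 l₀) ∧ Tendsto w atTop (𝓝 w₀)

/-- The derivative of `u = k x / l` at `(x₀, l₀)`, applied to the perturbation `(ζ, θ)`; real
perturbations have `V = ℝ`, exponential modes have `V = ℂ`. -/
def selectionRateLin {V : Type*} [NormedAddCommGroup V] [NormedSpace ℝ V]
    (k x₀ l₀ : ℝ) (ζ θ : V) : V :=
  deriv (fun x => selectionRate k x l₀) x₀ • ζ + deriv (fun l => selectionRate k x₀ l) l₀ • θ

/-- `(ζ, θ, η)` solves on `[-h, ∞)` the linearisation, around the constant solution with first two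
components `x₀, l₀`, of the system with constant arrival rate `β`. -/
structure IsLinearizedSolution {V : Type*} [NormedAddCommGroup V] [NormedSpace ℝ V]
    (β h p k x₀ l₀ : ℝ) (ζ θ η : ℝ → V) : Prop where
  continuousOn_ζ : ContinuousOn ζ (Ici (-h))
  continuousOn_θ : ContinuousOn θ (Ici (-h))
  deriv_ζ : ∀ t > 0,
    HasDerivAt ζ (-((p * β) • selectionRateLin k x₀ l₀ (ζ t) (θ t))) t
  deriv_θ : ∀ t > 0,
    HasDerivAt θ (-((p * β) • selectionRateLin k x₀ l₀ (ζ (t - h)) (θ (t - h)))) t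
  η_eq_sub : ∀ t ≥ -h, η t = θ t - ζ t
  η_eq_integral : ∀ t ≥ 0,
    η t = ∫ s in (t - h)..t, (p * β) • selectionRateLin k x₀ l₀ (ζ s) (θ s)

/-- Every solution of the linearised system tends to zero. -/
def IsLinearlyStable (β h p k x₀ l₀ : ℝ) : Prop :=
  ∀ ζ θ η : ℝ → ℝ, IsLinearizedSolution β h p k x₀ l₀ ζ θ η →
    Tendsto (fun t => max |ζ t| (max |θ t| |η t|)) atTop (𝓝 0)

/-- The spectrum of the linearised system: the `z` for which there is a nonzero solution of the form
`e ^ (z t) (ζ, θ, η)`. -/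
def linearizedSpectrum (β h p k x₀ l₀ : ℝ) : Set ℂ :=
  {z | ∃ ζ θ η : ℂ, (ζ, θ, η) ≠ 0 ∧
    IsLinearizedSolution β h p k x₀ l₀ (fun t : ℝ => Complex.exp (z * t) * ζ)
      (fun t : ℝ => Complex.exp (z * t) * θ) (fun t : ℝ => Complex.exp (z * t) * η)}

/-- The equilibrium number of free tips. -/
def xEq (β h p k : ℝ) : ℝ := h * β / (p * k - 1)

/-- The equilibrium number of tips. -/
def lEq (β h p k : ℝ) : ℝ := p * k * h / (p * k - 1) * β

/-- The equilibrium number of pending tips. -/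
def wEq (β h p k : ℝ) : ℝ := (p * k * h - h) / (p * k - 1) * β

end

/-! The integral relation removes one unknown. Integrating the equation for `x` over one delay and
comparing with `w = l - x` gives `l(t) = x(t - h) + hβ` for `t ≥ h`. The deviation `y = x - x̂`
therefore satisfies the scalar equation `y'(t) = g(t) (y(t - h) - c y(t))`, with `c = pk > 1` and `g
= β / l`; linearising only freezes `g` at `β / l̂`. The instantaneous damping `c` outweighs the
delayed feedback `1`, so `y` decays exponentially whatever the delay, provided `g` stays bounded
below (`delay_decay`). Both stability claims follow, since `l` is a delayed copy of `x` and `w = l -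
x`.

In the nonlinear case `g` is controlled only while `l` is near `l̂`. On the first delay interval
this comes from the initial data (`abs_l_sub_le`), later from the decay already proved one delay
earlier.

For the spectrum, the integral relation forces `θ = e^{-hz} ζ`, and the equation for `ζ` becomes the
characteristic equation. -/

/-! ### Scalar comparison and delay estimates -/

/-- A function that decreases wherever it exceeds `ρ` stays below `ρ`. -/
theorem le_of_deriv_nonpos_above {z z' : ℝ → ℝ} {T ρ : ℝ} (hz : ContinuousOn z (Icc 0 T))
    (hd : ∀ t ∈ Ioo 0 T, HasDerivAt z (z' t) t) (h0 : z 0 ≤ ρ)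
    (hneg : ∀ t ∈ Ioo 0 T, ρ < z t → z' t ≤ 0) : ∀ t ∈ Icc 0 T, z t ≤ ρ := by
  intro t₁ ht₁
  by_contra! hlt
  have hz₁ : ContinuousOn z (Icc 0 t₁) := hz.mono (Icc_subset_Icc_right ht₁.2)
  have hcomp : IsCompact (Icc 0 t₁ ∩ z ⁻¹' Iic ρ) :=
    (isCompact_Icc).of_isClosed_subset (hz₁.preimage_isClosed_of_isClosed isClosed_Icc isClosed_Iic)
      inter_subset_left
  -- `s` is the last time up to `t₁` with `z ≤ ρ`; from then on `z` cannot increase, so it cannot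
  -- have reached `z t₁ > ρ`.
  obtain ⟨s, ⟨hs, hsρ⟩, hmax⟩ := hcomp.exists_isGreatest ⟨0, ⟨le_rfl, ht₁.1⟩, h0⟩
  have habove : ∀ t ∈ Ioo s t₁, ρ < z t := by
    intro t ht
    by_contra! hle
    exact absurd (hmax ⟨⟨hs.1.trans ht.1.le, ht.2.le⟩, hle⟩) (not_le.2 ht.1)
  have hsub : ∀ t ∈ Ioo s t₁, t ∈ Ioo 0 T :=
    fun t ht => ⟨hs.1.trans_lt ht.1, ht.2.trans_le ht₁.2⟩
  have hanti : AntitoneOn z (Icc s t₁) := by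
    apply antitoneOn_of_deriv_nonpos (convex_Icc s t₁) (hz₁.mono (Icc_subset_Icc_left hs.1))
    · rw [interior_Icc]
      exact fun t ht => (hd t (hsub t ht)).differentiableAt.differentiableWithinAt
    · rw [interior_Icc]
      intro t ht
      rw [(hd t (hsub t ht)).deriv]
      exact hneg t (hsub t ht) (habove t ht)
  have := hanti (left_mem_Icc.2 hs.2) (right_mem_Icc.2 hs.2) hs.2
  exact absurd (this.trans hsρ) (not_le.2 hlt)

/-- Exponential upper bound for `y' = g (m - c y)` with exponentially decaying forcing `m`. -/
theorem le_exp_of_forcing_le {y m g : ℝ → ℝ} {T ρ r c g₀ q : ℝ}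
    (hy : ContinuousOn y (Icc 0 T))
    (hd : ∀ t ∈ Ioo 0 T, HasDerivAt y (g t * (m t - c * y t)) t)
    (h0 : y 0 ≤ ρ) (hρ : 0 ≤ ρ) (hg₀ : 0 ≤ g₀) (hq : q ≤ c) (hr : r ≤ g₀ * (c - q))
    (hg : ∀ t ∈ Ioo 0 T, g₀ ≤ g t)
    (hm : ∀ t ∈ Ioo 0 T, m t ≤ q * (ρ * Real.exp (-(r * t)))) (hq0 : 0 ≤ q) :
    ∀ t ∈ Icc 0 T, y t ≤ ρ * Real.exp (-(r * t)) := by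
  -- With `z = e^{rt} y`, wherever `z > ρ` the forcing bound gives `z' ≤ (r - g (c - q)) z ≤ 0`.
  have key := le_of_deriv_nonpos_above (z := fun t => Real.exp (r * t) * y t) (T := T) (ρ := ρ)
    (z' := fun t => Real.exp (r * t) * (r * 1) * y t
      + Real.exp (r * t) * (g t * (m t - c * y t)))
    ((by fun_prop : Continuous fun t : ℝ => Real.exp (r * t)).continuousOn.mul hy)
    (fun t ht => (((hasDerivAt_id t).const_mul r).exp).mul (hd t ht)) (by simpa using h0) ?_
  · intro t ht
    have h := key t ht
    rw [Real.exp_neg, ← div_eq_mul_inv, le_div_iff₀ (Real.exp_pos _), mul_comm]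
    exact h
  · intro t ht hlt
    have hE := Real.exp_pos (r * t)
    set E := Real.exp (r * t) with hEdef
    have hgt : g₀ ≤ g t := hg t ht
    have hmE : E * m t ≤ q * ρ := by
      have h1 := mul_le_mul_of_nonneg_left (hm t ht) hE.le
      rw [Real.exp_neg, ← hEdef] at h1
      calc E * m t ≤ E * (q * (ρ * E⁻¹)) := h1
        _ = q * ρ := by field_simp
    set z := E * y t with hzdef
    have hz0 : 0 ≤ z := hρ.trans hlt.le
    have h2 : E * m t ≤ q * z := hmE.trans (mul_le_mul_of_nonneg_left hlt.le hq0)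
    have h3 : g t * (E * m t) ≤ g t * (q * z) := mul_le_mul_of_nonneg_left h2 (hg₀.trans hgt)
    have h4 : r * z ≤ g t * (c - q) * z := by
      refine mul_le_mul_of_nonneg_right (hr.trans ?_) hz0
      exact mul_le_mul_of_nonneg_right hgt (sub_nonneg.2 hq)
    have h5 : E * (r * 1) * y t + E * (g t * (m t - c * y t))
        = r * z + (g t * (E * m t) - g t * c * z) := by rw [hzdef]; ring
    rw [h5]
    linarith

theorem abs_le_exp_of_abs_forcing_le {y m g : ℝ → ℝ} {T ρ r c g₀ q : ℝ}
    (hy : ContinuousOn y (Icc 0 T))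
    (hd : ∀ t ∈ Ioo 0 T, HasDerivAt y (g t * (m t - c * y t)) t)
    (h0 : |y 0| ≤ ρ) (hg₀ : 0 ≤ g₀) (hq : q ≤ c) (hr : r ≤ g₀ * (c - q))
    (hg : ∀ t ∈ Ioo 0 T, g₀ ≤ g t)
    (hm : ∀ t ∈ Ioo 0 T, |m t| ≤ q * (ρ * Real.exp (-(r * t)))) (hq0 : 0 ≤ q) :
    ∀ t ∈ Icc 0 T, |y t| ≤ ρ * Real.exp (-(r * t)) := by
  intro t ht
  have hρ : 0 ≤ ρ := (abs_nonneg _).trans h0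
  refine abs_le'.2 ⟨?_, ?_⟩
  · exact le_exp_of_forcing_le hy hd ((le_abs_self _).trans h0) hρ hg₀ hq hr hg
      (fun t ht => (le_abs_self _).trans (hm t ht)) hq0 t ht
  · refine le_exp_of_forcing_le (y := fun t => -y t) (m := fun t => -m t) hy.neg
      (fun t ht => ?_) ((neg_le_abs _).trans h0) hρ hg₀ hq hr hg
      (fun t ht => (neg_le_abs _).trans (hm t ht)) hq0 t ht
    exact (hd t ht).fun_neg.congr_deriv (by ring)

/-- Delay-independent exponential decay for `y'(t) = g(t) (y(t - h) - c y(t))`, where the rate `g`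
is only known to be bounded below while the delayed term is small. -/
theorem delay_decay {y m g : ℝ → ℝ} {T h ρ r c g₀ : ℝ} (hh : 0 < h) (hr0 : 0 ≤ r)
    (hy : ContinuousOn y (Icc 0 T))
    (hd : ∀ t ∈ Ioo 0 T, HasDerivAt y (g t * (m t - c * y t)) t)
    (h0 : |y 0| ≤ ρ) (hg₀ : 0 ≤ g₀) (hq : Real.exp (r * h) ≤ c)
    (hr : r ≤ g₀ * (c - Real.exp (r * h)))
    (hm : ∀ t ∈ Icc 0 T, t ≤ h → |m t| ≤ ρ) (hdelay : ∀ t ∈ Icc 0 T, h ≤ t → m t = y (t - h))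
    (hg : ∀ t ∈ Ioo 0 T, |m t| ≤ ρ → g₀ ≤ g t) :
    ∀ t ∈ Icc 0 T, |y t| ≤ ρ * Real.exp (-(r * t)) := by
  have hρ : 0 ≤ ρ := (abs_nonneg _).trans h0
  -- Method of steps: the decay up to time `n h` bounds `m` up to `(n + 1) h`. This bound first
  -- secures `g₀ ≤ g` and then serves as the forcing bound with `q = e^{rh}`, the price of shifting
  -- the exponential by one delay.
  have step : ∀ n : ℕ, ∀ t ∈ Icc 0 T, t ≤ n * h → |y t| ≤ ρ * Real.exp (-(r * t)) := by
    intro n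
    induction n with
    | zero =>
      intro t ht hn
      have : t = 0 := le_antisymm (by simpa using hn) ht.1
      simpa [this] using h0
    | succ n ih =>
      have hle : min T ((n + 1 : ℕ) * h) ≤ T := min_le_left _ _
      have hcases : ∀ t ∈ Ioo 0 (min T ((n + 1 : ℕ) * h)),
          |m t| ≤ ρ ∧ |m t| ≤ Real.exp (r * h) * (ρ * Real.exp (-(r * t))) := by
        intro t ht
        have htT : t ∈ Icc 0 T := ⟨ht.1.le, ht.2.le.trans hle⟩
        rcases le_total t h with hth | hth
        · refine ⟨hm t htT hth, (hm t htT hth).trans ?_⟩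
          have : 1 ≤ Real.exp (r * h) * Real.exp (-(r * t)) := by
            rw [← Real.exp_add]
            apply Real.one_le_exp
            nlinarith
          nlinarith
        · have hb := ih (t - h) ⟨by linarith, by linarith [htT.2]⟩ (by
            have := ht.2.le.trans (min_le_right _ _)
            push_cast at this
            linarith)
          rw [← hdelay t htT hth] at hb
          refine ⟨hb.trans (mul_le_of_le_one_right hρ ?_), hb.trans_eq ?_⟩
          · apply Real.exp_le_one_iff.2
            nlinarith
          · rw [mul_left_comm, ← Real.exp_add]
            congr 2
            ring
      intro t ht hn
      exact abs_le_exp_of_abs_forcing_le (hy.mono (Icc_subset_Icc_right hle))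
        (fun s hs => hd s ⟨hs.1, hs.2.trans_le hle⟩) h0 hg₀ hq hr
        (fun s hs => hg s ⟨hs.1, hs.2.trans_le hle⟩ (hcases s hs).1)
        (fun s hs => (hcases s hs).2) (Real.exp_pos _).le t ⟨ht.1, le_min ht.2 hn⟩
  intro t ht
  obtain ⟨n, hn⟩ := exists_nat_ge (t / h)
  exact step n t ht ((div_le_iff₀ hh).1 hn)

/-- Every `c > 1` leaves room for a positive exponential decay rate. -/
theorem exists_decay_rate {h c g₀ : ℝ} (hc : 1 < c) (hg₀ : 0 < g₀) :
    ∃ r > 0, Real.exp (r * h) ≤ c ∧ r ≤ g₀ * (c - Real.exp (r * h)) := by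
  -- Both inequalities are strict at `r = 0`, hence persist for small `r > 0`.
  have h1 : ∀ᶠ r in 𝓝 (0 : ℝ), Real.exp (r * h) < c :=
    (by fun_prop : Continuous fun r : ℝ => Real.exp (r * h)).continuousAt.eventually_lt
      continuousAt_const (by simpa using hc)
  have h2 : ∀ᶠ r in 𝓝 (0 : ℝ), r < g₀ * (c - Real.exp (r * h)) :=
    continuousAt_id.eventually_lt
      (by fun_prop : Continuous fun r : ℝ => g₀ * (c - Real.exp (r * h))).continuousAt
      (by simpa using mul_pos hg₀ (sub_pos.2 hc))
  obtain ⟨r, ⟨hr1, hr2⟩, hr⟩ :=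
    ((h1.and h2).filter_mono nhdsWithin_le_nhds |>.and self_mem_nhdsWithin :
      ∀ᶠ r in 𝓝[>] (0 : ℝ), _ ∧ r ∈ Ioi 0).exists
  exact ⟨r, hr, hr1.le, hr2.le⟩

theorem tendsto_zero_of_abs_le_exp {y : ℝ → ℝ} {ρ r : ℝ} (hr : 0 < r)
    (hy : ∀ t ≥ 0, |y t| ≤ ρ * Real.exp (-(r * t))) : Tendsto y atTop (𝓝 0) := by
  have h1 : Tendsto (fun t : ℝ => ρ * Real.exp (-(r * t))) atTop (𝓝 0) := by
    simpa using (Real.tendsto_exp_neg_atTop_nhds_zero.comp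
      (tendsto_id.const_mul_atTop hr)).const_mul ρ
  exact squeeze_zero_norm' ((eventually_ge_atTop 0).mono fun t ht => hy t ht) h1

theorem tendsto_zero_of_delay {y m : ℝ → ℝ} {h : ℝ} (hy : Tendsto y atTop (𝓝 0))
    (hm : ∀ t ≥ h, m t = y (t - h)) : Tendsto m atTop (𝓝 0) := by
  refine (hy.comp (tendsto_atTop_add_const_right atTop (-h) tendsto_id)).congr' ?_
  exact (eventually_ge_atTop h).mono fun t ht => (hm t ht).symm

/-! ### The constant solution and the linearised rate -/

section Equilibrium

variable {β h p k : ℝ}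

theorem lEq_eq_mul_xEq (β h p k : ℝ) : lEq β h p k = p * k * xEq β h p k := by
  unfold lEq xEq; ring

theorem wEq_eq (hpk : 0 < p * k - 1) : wEq β h p k = h * β := by
  unfold wEq; field_simp

theorem lEq_eq_add_xEq (hpk : 0 < p * k - 1) : lEq β h p k = xEq β h p k + h * β := by
  unfold lEq xEq; field_simp; ring

theorem xEq_pos (hβ : 0 < β) (hh : 0 < h) (hpk : 0 < p * k - 1) : 0 < xEq β h p k :=
  div_pos (mul_pos hh hβ) hpk

theorem lEq_pos (hβ : 0 < β) (hh : 0 < h) (hpk : 0 < p * k - 1) : 0 < lEq β h p k := by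
  rw [lEq_eq_mul_xEq]
  exact mul_pos (by linarith) (xEq_pos hβ hh hpk)

theorem isTangleSolution_const_iff (hβ : 0 < β) (hh : 0 < h) (hpk : 0 < p * k - 1)
    (x₀ l₀ w₀ : ℝ) :
    IsTangleSolution (fun _ => β) h p k (fun _ => x₀) (fun _ => l₀) (fun _ => w₀) ↔
      x₀ = xEq β h p k ∧ l₀ = lEq β h p k ∧ w₀ = wEq β h p k := by
  constructor
  · intro H
    have H1 := H 1 one_pos
    have hl : l₀ ≠ 0 := H1.l_ne_zero 0 ⟨by linarith, zero_le_one⟩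
    have hx := (H1.deriv_x (1 / 2) (by norm_num)).unique (hasDerivAt_const _ _)
    have hw := H1.w_eq_sub 0 ⟨by linarith, zero_le_one⟩
    have hi := H1.w_eq_integral 0 ⟨le_rfl, zero_le_one⟩
    simp only [intervalIntegral.integral_const, smul_eq_mul, selectionRate] at hx hw hi
    -- A constant has zero derivative, so the outflow `p β u` balances `β`; the integral relation
    -- then fixes `w₀ = h β`.
    have hu : p * β * (k * x₀ / l₀) = β := by linarith
    rw [hu] at hi
    have hlx : l₀ = p * k * x₀ := by
      field_simp at hu
      linarith
    have hx₀ : x₀ = xEq β h p k := by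
      rw [xEq, eq_div_iff hpk.ne']
      linarith
    refine ⟨hx₀, ?_, ?_⟩
    · rw [hlx, hx₀, lEq_eq_mul_xEq]
    · rw [wEq_eq hpk, hi]; ring
  · rintro ⟨rfl, rfl, rfl⟩ T hT
    have hl := lEq_pos hβ hh hpk
    have hu : p * β * selectionRate k (xEq β h p k) (lEq β h p k) = β := by
      have hx := (xEq_pos hβ hh hpk).ne'
      have hc : p * k ≠ 0 := by linarith
      have h1 : p * β * (k * xEq β h p k / (p * k * xEq β h p k))
          = β * ((p * k * xEq β h p k) / (p * k * xEq β h p k)) := by ring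
      rw [selectionRate, lEq_eq_mul_xEq, h1, div_self (mul_ne_zero hc hx), mul_one]
    exact
      { continuousOn_x := continuousOn_const
        continuousOn_l := continuousOn_const
        l_ne_zero := fun _ _ => hl.ne'
        deriv_x := fun t _ => by rw [hu, sub_self]; exact hasDerivAt_const _ _
        deriv_l := fun t _ => by rw [hu, sub_self]; exact hasDerivAt_const _ _
        w_eq_sub := fun t _ => by rw [wEq_eq hpk, lEq_eq_add_xEq hpk]; ring
        w_eq_integral := fun t _ => by
          rw [hu, wEq_eq hpk, intervalIntegral.integral_const, smul_eq_mul]; ring }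

theorem smul_selectionRateLin {V : Type*} [NormedAddCommGroup V] [NormedSpace ℝ V]
    (hβ : 0 < β) (hh : 0 < h) (hpk : 0 < p * k - 1) (ζ θ : V) :
    (p * β) • selectionRateLin k (xEq β h p k) (lEq β h p k) ζ θ
      = ((p * k - 1) / (h * (p * k))) • ((p * k) • ζ - θ) := by
  have hl := (lEq_pos hβ hh hpk).ne'
  have hc : p * k ≠ 0 := by linarith
  have hp : p ≠ 0 := left_ne_zero_of_mul hc
  have hk : k ≠ 0 := right_ne_zero_of_mul hc
  have h1 : deriv (fun x => selectionRate k x (lEq β h p k)) (xEq β h p k)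
      = k / lEq β h p k := by
    simp [selectionRate]
  have h2 : deriv (fun l => selectionRate k (xEq β h p k) l) (lEq β h p k)
      = -(k * xEq β h p k / lEq β h p k ^ 2) := by
    have := (hasDerivAt_inv hl).const_mul (k * xEq β h p k)
    have h3 := this.deriv
    simp only [selectionRate, div_eq_mul_inv]
    rw [h3]; ring
  have hd := hpk.ne'
  rw [selectionRateLin, h1, h2, smul_add, smul_sub, smul_smul, smul_smul, smul_smul, sub_eq_add_neg,
    ← neg_smul]
  congr 2
  · unfold lEq; field_simp
  · unfold lEq xEq; field_simp

end Equilibrium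

/-! ### The linearised system and its spectrum -/

section Linear

variable {β h p k : ℝ}

/-- After one delay the total tips of the linearised system follow the delayed free tips. -/
theorem IsLinearizedSolution.θ_eq_delay {x₀ l₀ : ℝ} {ζ θ η : ℝ → ℝ} (hh : 0 < h)
    (H : IsLinearizedSolution β h p k x₀ l₀ ζ θ η) {t : ℝ} (ht : h ≤ t) : θ t = ζ (t - h) := by
  have hsub : Icc (t - h) t ⊆ Ici (-h) := fun s hs => by
    have := hs.1
    simp only [mem_Ici]; linarith
  have hcont : ContinuousOn
      (fun s => -((p * β) • selectionRateLin k x₀ l₀ (ζ s) (θ s))) (Icc (t - h) t) := by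
    have h1 := H.continuousOn_ζ.mono hsub
    have h2 := H.continuousOn_θ.mono hsub
    unfold selectionRateLin
    fun_prop
  have hle : t - h ≤ t := by linarith
  have h1 := intervalIntegral.integral_eq_sub_of_hasDerivAt_of_le hle
    (H.continuousOn_ζ.mono hsub) (fun s hs => H.deriv_ζ s (by linarith [hs.1]))
    (hcont.intervalIntegrable_of_Icc hle)
  have h2 := H.η_eq_sub t (by linarith)
  have h3 := H.η_eq_integral t (by linarith)
  rw [intervalIntegral.integral_neg, ← h3] at h1
  linarith

theorem isLinearlyStable_eq (hβ : 0 < β) (hh : 0 < h) (hpk : 0 < p * k - 1) :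
    IsLinearlyStable β h p k (xEq β h p k) (lEq β h p k) := by
  intro ζ θ η H
  have hc : 1 < p * k := by linarith
  have hg : 0 < (p * k - 1) / (h * (p * k)) := div_pos hpk (mul_pos hh (by linarith))
  obtain ⟨r, hr, hr1, hr2⟩ := exists_decay_rate (h := h) hc hg
  have hsub : ∀ T, Icc 0 T ⊆ Ici (-h) := fun T s hs => by
    have := hs.1
    simp only [mem_Ici]; linarith
  -- Before time `h` the function `θ` is not yet a delayed `ζ`; there compactness supplies its
  -- bound.
  obtain ⟨C, hC⟩ := isCompact_Icc.exists_bound_of_continuousOn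
    (H.continuousOn_θ.mono (hsub h))
  have hdecay : ∀ t ≥ 0, |ζ t| ≤ max C |ζ 0| * Real.exp (-(r * t)) := by
    intro t ht
    refine delay_decay (T := t) (m := θ) (g := fun _ => (p * k - 1) / (h * (p * k)))
      (g₀ := (p * k - 1) / (h * (p * k))) hh hr.le (H.continuousOn_ζ.mono (hsub t)) ?_
      (le_max_right _ _) hg.le hr1 hr2 (fun s hs hsh => (hC s ⟨hs.1, hsh⟩).trans (le_max_left _ _))
      (fun s _ hs => H.θ_eq_delay hh hs) (fun _ _ _ => le_rfl) t ⟨ht, le_rfl⟩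
    intro s hs
    refine (H.deriv_ζ s hs.1).congr_deriv ?_
    rw [smul_selectionRateLin hβ hh hpk]
    simp only [smul_eq_mul]
    ring
  have hζ := tendsto_zero_of_abs_le_exp hr hdecay
  have hθ : Tendsto θ atTop (𝓝 0) := tendsto_zero_of_delay hζ fun t ht => H.θ_eq_delay hh ht
  have hη : Tendsto η atTop (𝓝 0) := by
    have := hθ.sub hζ
    rw [sub_zero] at this
    exact this.congr' ((eventually_ge_atTop (-h)).mono fun t ht => (H.η_eq_sub t ht).symm)
  simpa using hζ.abs.max (hθ.abs.max hη.abs)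

theorem hasDerivAt_exp_mode (z ζ : ℂ) (t : ℝ) :
    HasDerivAt (fun t : ℝ => Complex.exp (z * t) * ζ) (z * (Complex.exp (z * t) * ζ)) t := by
  have h1 : HasDerivAt (fun t : ℂ => Complex.exp (z * t)) (Complex.exp (z * t) * (z * 1)) t :=
    ((hasDerivAt_id (t : ℂ)).const_mul z).cexp
  exact (h1.comp_ofReal.mul_const ζ).congr_deriv (by ring)

theorem integral_exp_mode (z ζ : ℂ) (a b : ℝ) :
    ∫ s in a..b, z * (Complex.exp (z * s) * ζ)
      = Complex.exp (z * b) * ζ - Complex.exp (z * a) * ζ :=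
  intervalIntegral.integral_eq_sub_of_hasDerivAt (fun s _ => hasDerivAt_exp_mode z ζ s)
    (Continuous.intervalIntegrable (by fun_prop) _ _)

theorem exp_mode_delay (z ζ : ℂ) (h t : ℝ) :
    Complex.exp (z * (t - h : ℝ)) * ζ
      = Complex.exp (z * t) * (Complex.exp (-(h * z)) * ζ) := by
  rw [← mul_assoc, ← Complex.exp_add]
  congr 2
  push_cast
  ring

theorem smul_selectionRateLin_exp_mode (hβ : 0 < β) (hh : 0 < h) (hpk : 0 < p * k - 1)
    (e ζ θ : ℂ) :
    (p * β) • selectionRateLin k (xEq β h p k) (lEq β h p k) (e * ζ) (e * θ)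
      = e * (((p * k - 1) / (h * (p * k)) : ℝ) * ((p * k : ℝ) * ζ - θ)) := by
  rw [smul_selectionRateLin hβ hh hpk]
  simp only [Complex.real_smul]
  ring

theorem characteristic_iff (hh : 0 < h) (hpk : 0 < p * k - 1) (z E : ℂ) :
    ((p * k : ℝ) : ℂ) + ((p * k / (p * k - 1) : ℝ) : ℂ) * (h * z) = E ↔
      z = -(((p * k - 1) / (h * (p * k)) : ℝ) * ((p * k : ℝ) - E)) := by
  generalize hc : p * k = c at *
  have hc0 : (c : ℂ) ≠ 0 := by
    exact_mod_cast (by linarith : (0 : ℝ) < c).ne'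
  have hc1 : (c : ℂ) - 1 ≠ 0 := by exact_mod_cast hpk.ne'
  have hh0 : (h : ℂ) ≠ 0 := by exact_mod_cast hh.ne'
  push_cast
  constructor
  · rintro rfl
    field_simp
    ring
  · intro hz
    have : E = c + z * (h * c / (c - 1)) := by
      have h1 : z * (h * c / (c - 1)) = -(c - E) := by
        nth_rewrite 1 [hz]
        field_simp
      rw [h1]; ring
    rw [this]
    field_simp

theorem mem_linearizedSpectrum_iff (hβ : 0 < β) (hh : 0 < h) (hpk : 0 < p * k - 1) (z : ℂ) :
    z ∈ linearizedSpectrum β h p k (xEq β h p k) (lEq β h p k) ↔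
      ((p * k : ℝ) : ℂ) + ((p * k / (p * k - 1) : ℝ) : ℂ) * (h * z) = Complex.exp (-(h * z)) := by
  rw [characteristic_iff hh hpk]
  have hlin := smul_selectionRateLin_exp_mode hβ hh hpk
  set g : ℂ := (((p * k - 1) / (h * (p * k)) : ℝ) : ℂ) with hg
  set c : ℂ := ((p * k : ℝ) : ℂ)
  set E := Complex.exp (-(h * z)) with hE
  constructor
  · rintro ⟨ζ, θ, η, hne, H⟩
    have hmode : -(g * (c * ζ - θ)) = z * ζ := by
      have h1 := (H.deriv_ζ h hh).unique (hasDerivAt_exp_mode z ζ h)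
      rw [hlin] at h1
      have he := Complex.exp_ne_zero (z * h)
      apply mul_left_cancel₀ he
      linear_combination h1
    have hint := H.η_eq_integral 0 le_rfl
    have hη := H.η_eq_sub 0 (by linarith)
    have hcongr : ∀ s : ℝ, (p * β) • selectionRateLin k (xEq β h p k) (lEq β h p k)
        (Complex.exp (z * s) * ζ) (Complex.exp (z * s) * θ)
        = -(z * (Complex.exp (z * s) * ζ)) := by
      intro s
      rw [hlin]
      linear_combination (-Complex.exp (z * s)) * hmode
    simp only [hcongr] at hint
    rw [intervalIntegral.integral_neg, integral_exp_mode, exp_mode_delay, ← hE] at hint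
    simp only [Complex.ofReal_zero, mul_zero, Complex.exp_zero, one_mul] at hint hη
    have hθ : θ = E * ζ := by linear_combination hint - hη
    -- If `ζ = 0`, then `θ = E ζ` and `η = θ - ζ` vanish too.
    have hζ : ζ ≠ 0 := by
      rintro rfl
      apply hne
      rw [mul_zero] at hθ
      subst hθ
      simpa using hη
    apply mul_right_cancel₀ hζ
    rw [hθ] at hmode
    linear_combination -hmode
  · intro hz
    have hcongr : ∀ s : ℝ, (p * β) • selectionRateLin k (xEq β h p k) (lEq β h p k)
        (Complex.exp (z * s) * 1) (Complex.exp (z * s) * E)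
        = -(z * (Complex.exp (z * s) * 1)) := by
      intro s
      rw [hlin]
      linear_combination Complex.exp (z * s) * hz
    refine ⟨1, E, E - 1, by simp, ?_⟩
    exact
      { continuousOn_ζ := by fun_prop
        continuousOn_θ := by fun_prop
        deriv_ζ := fun t _ => by
          rw [hcongr, neg_neg]
          exact hasDerivAt_exp_mode z 1 t
        deriv_θ := fun t _ => by
          rw [hcongr, neg_neg, exp_mode_delay, mul_one]
          exact hasDerivAt_exp_mode z E t
        η_eq_sub := fun t _ => by ring
        η_eq_integral := fun t _ => by
          simp only [hcongr]
          rw [intervalIntegral.integral_neg, integral_exp_mode, exp_mode_delay, ← hE]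
          ring }

/-- For `Re z ≥ 0` the left side has real part at least `c > 1`, while the right side has modulus at
most `1`. -/
theorem re_neg_of_characteristic {c h : ℝ} (hh : 0 < h) (hc : 0 < c - 1) {z : ℂ}
    (hz : (c : ℂ) + ((c / (c - 1) : ℝ) : ℂ) * (h * z) = Complex.exp (-(h * z))) : z.re < 0 := by
  by_contra! hre
  have h1 : ‖Complex.exp (-(h * z))‖ ≤ 1 := by
    rw [Complex.norm_exp]
    apply Real.exp_le_one_iff.2
    simpa using mul_nonneg hh.le hre
  have h2 : c ≤ ((c : ℂ) + ((c / (c - 1) : ℝ) : ℂ) * (h * z)).re := by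
    rw [Complex.add_re, Complex.re_ofReal_mul, Complex.re_ofReal_mul, Complex.ofReal_re]
    have : 0 ≤ c / (c - 1) * (h * z.re) :=
      mul_nonneg (div_nonneg (by linarith) hc.le) (mul_nonneg hh.le hre)
    linarith
  rw [hz] at h2
  linarith [Complex.re_le_norm (Complex.exp (-(h * z)))]

end Linear

/-! ### Local asymptotic stability of the nonlinear system -/

section Nonlinear

variable {β h p k T : ℝ} {x l w : ℝ → ℝ}

/-- After one delay the total tips equal the delayed free tips plus the arrivals in one delay. -/
theorem IsTangleSolutionOn.l_eq_delay (hh : 0 < h)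
    (H : IsTangleSolutionOn (fun _ => β) h p k T x l w) {t : ℝ} (ht : h ≤ t) (htT : t ≤ T) :
    l t = x (t - h) + h * β := by
  have hsub : Icc (t - h) t ⊆ Icc (-h) T :=
    Icc_subset_Icc (by linarith) htT
  have hcont : ContinuousOn (fun s => p * β * selectionRate k (x s) (l s)) (Icc (t - h) t) := by
    unfold selectionRate
    exact continuousOn_const.mul ((continuousOn_const.mul (H.continuousOn_x.mono hsub)).div
      (H.continuousOn_l.mono hsub) fun s hs => H.l_ne_zero s (hsub hs))
  have hle : t - h ≤ t := by linarith
  have hint := hcont.intervalIntegrable_of_Icc (μ := MeasureTheory.volume) hle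
  have h1 := intervalIntegral.integral_eq_sub_of_hasDerivAt_of_le hle
    (H.continuousOn_x.mono hsub)
    (fun s hs => H.deriv_x s ⟨by linarith [hs.1], hs.2.trans_le htT⟩)
    (intervalIntegrable_const.sub hint)
  have h2 := H.w_eq_sub t ⟨by linarith, htT⟩
  have h3 := H.w_eq_integral t ⟨by linarith, htT⟩
  rw [intervalIntegral.integral_sub intervalIntegrable_const hint, ← h3,
    intervalIntegral.integral_const, smul_eq_mul] at h1
  linarith

/-- The drift of either component in terms of the deviation from equilibrium. -/
theorem drift_eq {X L : ℝ} (hL : L ≠ 0) :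
    β - p * β * selectionRate k X L
      = β / L * ((L - lEq β h p k) - p * k * (X - xEq β h p k)) := by
  rw [lEq_eq_mul_xEq, selectionRate]
  field_simp
  ring

/-- On the first delay interval the deviation of `l` is controlled by the initial data. -/
theorem IsTangleSolutionOn.abs_l_sub_le {δ : ℝ} (hβ : 0 < β) (hh : 0 < h)
    (hpk : 0 < p * k - 1) (hδ : δ ≤ lEq β h p k / 2)
    (H : IsTangleSolutionOn (fun _ => β) h p k T x l w)
    (H0 : InitiallyClose h δ (xEq β h p k) (lEq β h p k) (wEq β h p k) x l w)
    {t : ℝ} (ht : t ∈ Icc 0 T) (hth : t ≤ h) :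
    |l t - lEq β h p k| ≤ (1 + h * (2 * β / lEq β h p k * (1 + p * k))) * δ := by
  have hl := lEq_pos hβ hh hpk
  have hl0 := (H0 0 ⟨by linarith, le_rfl⟩).2.1
  have hδ0 : 0 < δ := (abs_nonneg _).trans_lt hl0
  have hK : 0 ≤ 2 * β / lEq β h p k * (1 + p * k) :=
    mul_nonneg (by positivity) (by linarith)
  rcases ht.1.eq_or_lt with rfl | ht0
  · nlinarith [mul_nonneg hh.le hK]
  -- Mean value theorem: for `0 < s < h` the slope of `l` at `s` involves only values at `s - h`,
  -- which are initial data.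
  · obtain ⟨s, hs, hslope⟩ := exists_hasDerivAt_eq_slope l _ ht0
      (H.continuousOn_l.mono (Icc_subset_Icc (by linarith) ht.2))
      (fun s hs => H.deriv_l s ⟨hs.1, hs.2.trans_le ht.2⟩)
    have hsmem : s - h ∈ Icc (-h) 0 := ⟨by linarith [hs.1], by linarith [hs.2]⟩
    obtain ⟨hxs, hls, -⟩ := H0 _ hsmem
    have hLlow : lEq β h p k / 2 < l (s - h) := by
      have := (abs_lt.1 hls).1
      linarith
    have hLpos : 0 < l (s - h) := by linarith
    rw [drift_eq (h := h) hLpos.ne'] at hslope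
    have hnum : |(l (s - h) - lEq β h p k) - p * k * (x (s - h) - xEq β h p k)|
        ≤ (1 + p * k) * δ := by
      refine (abs_sub _ _).trans ?_
      rw [abs_mul, abs_of_pos (by linarith : 0 < p * k)]
      nlinarith
    have hcoef : β / l (s - h) ≤ 2 * β / lEq β h p k := by
      rw [div_le_div_iff₀ hLpos hl]
      nlinarith
    have hslope_le : |(l t - l 0) / (t - 0)| ≤ 2 * β / lEq β h p k * ((1 + p * k) * δ) := by
      rw [← hslope, abs_mul, abs_of_pos (div_pos hβ hLpos)]
      exact mul_le_mul hcoef hnum (abs_nonneg _) (by positivity)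
    rw [sub_zero, abs_div, abs_of_pos ht0, div_le_iff₀ ht0] at hslope_le
    have hKδ : 0 ≤ 2 * β / lEq β h p k * ((1 + p * k) * δ) := by
      rw [← mul_assoc]; exact mul_nonneg hK hδ0.le
    have htri : |l t - lEq β h p k| ≤ |l t - l 0| + |l 0 - lEq β h p k| := abs_sub_le _ _ _
    have := mul_le_mul_of_nonneg_left hth hKδ
    linarith

/-- Near the equilibrium, sufficiently small initial deviations decay exponentially. -/
theorem exists_nonlinear_decay (hβ : 0 < β) (hh : 0 < h) (hpk : 0 < p * k - 1) :
    ∃ r > 0, ∀ ρ > 0, ρ ≤ lEq β h p k / 2 → ∃ δ > 0, ∀ T > 0, ∀ x l w : ℝ → ℝ,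
      IsTangleSolutionOn (fun _ => β) h p k T x l w →
      InitiallyClose h δ (xEq β h p k) (lEq β h p k) (wEq β h p k) x l w →
        (∀ t ∈ Icc 0 T, |x t - xEq β h p k| ≤ ρ * Real.exp (-(r * t))) ∧
        ∀ t ∈ Icc 0 T, t ≤ h → |l t - lEq β h p k| ≤ ρ := by
  have hl := lEq_pos hβ hh hpk
  -- While `l` is within `l̂ / 2` of `l̂` one has `0 < l < 2 l̂`, so this is a lower bound for `β /
  -- l`. It does not involve `ρ`, so one rate `r` serves every `ρ`.
  have hg : 0 < β / (2 * lEq β h p k) := by positivity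
  obtain ⟨r, hr, hr1, hr2⟩ := exists_decay_rate (h := h) (by linarith : 1 < p * k) hg
  refine ⟨r, hr, fun ρ hρ hρl => ?_⟩
  -- `K` is the amplification factor of `abs_l_sub_le`; taking `δ = ρ / K` keeps `l` within `ρ` of
  -- equilibrium up to time `h`, and `K ≥ 1` does the same for `x` at time `0`.
  set K := 1 + h * (2 * β / lEq β h p k * (1 + p * k)) with hKdef
  have hK : 1 ≤ K := by
    have : 0 ≤ 2 * β / lEq β h p k * (1 + p * k) := mul_nonneg (by positivity) (by linarith)
    nlinarith [mul_nonneg hh.le this]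
  have hKpos : 0 < K := by linarith
  have hδρ : ρ / K ≤ ρ := div_le_self hρ.le hK
  refine ⟨ρ / K, by positivity, fun T hT x l w H H0 => ?_⟩
  have hlb : ∀ t ∈ Icc 0 T, t ≤ h → |l t - lEq β h p k| ≤ ρ := by
    intro t ht hth
    refine (H.abs_l_sub_le hβ hh hpk (hδρ.trans hρl) H0 ht hth).trans_eq ?_
    rw [← hKdef]
    field_simp
  refine ⟨?_, hlb⟩
  refine delay_decay (m := fun t => l t - lEq β h p k) (g := fun t => β / l t)
    (g₀ := β / (2 * lEq β h p k)) (y := fun t => x t - xEq β h p k) hh hr.le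
    ((H.continuousOn_x.mono (Icc_subset_Icc_left (by linarith))).sub continuousOn_const)
    (fun t ht => ?_) ((H0 0 ⟨by linarith, le_rfl⟩).1.le.trans hδρ) hg.le hr1 hr2 hlb
    (fun t ht hth => ?_) (fun t ht hm => ?_)
  · rw [← drift_eq (H.l_ne_zero t ⟨by linarith [ht.1], ht.2.le⟩)]
    exact (H.deriv_x t ht).sub_const _
  · rw [H.l_eq_delay hh hth ht.2, lEq_eq_add_xEq hpk]
    ring
  · have := abs_le.1 hm
    exact div_le_div_of_nonneg_left hβ.le (by linarith) (by linarith)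

theorem isLocallyAsymptoticallyStable_eq (hβ : 0 < β) (hh : 0 < h) (hpk : 0 < p * k - 1) :
    IsLocallyAsymptoticallyStable (fun _ => β) h p k
      (xEq β h p k) (lEq β h p k) (wEq β h p k) := by
  have hl := lEq_pos hβ hh hpk
  obtain ⟨r, hr, hdecay⟩ := exists_nonlinear_decay hβ hh hpk
  have hw : wEq β h p k = lEq β h p k - xEq β h p k := by
    rw [wEq_eq hpk, lEq_eq_add_xEq hpk]; ring
  constructor
  · intro ε hε
    -- The deviation of `w` is at most the sum of those of `x` and `l`, hence at most `2ε/3 < ε`.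
    obtain ⟨δ, hδ, hb⟩ := hdecay (min (ε / 3) (lEq β h p k / 2)) (by positivity)
      (min_le_right _ _)
    refine ⟨δ, hδ, fun T hT x l w H H0 t ht => ?_⟩
    obtain ⟨hx, hlb⟩ := hb T hT x l w H H0
    have hx3 : ∀ t ∈ Icc 0 T, |x t - xEq β h p k| ≤ ε / 3 := by
      intro t ht
      refine (hx t ht).trans ((mul_le_of_le_one_right (by positivity) ?_).trans (min_le_left _ _))
      exact Real.exp_le_one_iff.2 (neg_nonpos.2 (mul_nonneg hr.le ht.1))
    have hl3 : |l t - lEq β h p k| ≤ ε / 3 := by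
      rcases le_total t h with hth | hth
      · exact (hlb t ht hth).trans (min_le_left _ _)
      · have := hx3 (t - h) ⟨by linarith, by linarith [ht.2]⟩
        rw [H.l_eq_delay hh hth ht.2, lEq_eq_add_xEq hpk]
        rwa [add_sub_add_right_eq_sub]
    have hxt := hx3 t ht
    refine ⟨by linarith, by linarith, ?_⟩
    rw [H.w_eq_sub t ⟨by linarith [ht.1], ht.2⟩, hw, sub_sub_sub_comm]
    linarith [abs_sub (l t - lEq β h p k) (x t - xEq β h p k)]
  · obtain ⟨δ, hδ, hb⟩ := hdecay (lEq β h p k / 2) (by positivity) le_rfl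
    refine ⟨δ, hδ, fun x l w H H0 => ?_⟩
    have hx0 : Tendsto (fun t => x t - xEq β h p k) atTop (𝓝 0) := by
      refine tendsto_zero_of_abs_le_exp (ρ := lEq β h p k / 2) hr fun t ht => ?_
      exact (hb (t + 1) (by linarith) x l w (H _ (by linarith)) H0).1 t ⟨ht, by linarith⟩
    have hl0 : Tendsto (fun t => l t - lEq β h p k) atTop (𝓝 0) := by
      refine tendsto_zero_of_delay (h := h) hx0 fun t ht => ?_
      rw [(H t (by linarith)).l_eq_delay hh ht le_rfl, lEq_eq_add_xEq hpk]
      ring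
    have hx := tendsto_sub_nhds_zero_iff.1 hx0
    have hl := tendsto_sub_nhds_zero_iff.1 hl0
    refine ⟨hx, hl, ?_⟩
    rw [hw]
    refine (hl.sub hx).congr' ((eventually_gt_atTop 0).mono fun t ht => ?_)
    exact ((H t ht).w_eq_sub t ⟨by linarith, le_rfl⟩).symm

end Nonlinear

theorem theorem1 (β h p k : ℝ) (hβ : 0 < β) (hh : 0 < h) (hp : p ∈ Set.Icc (0 : ℝ) 1)
    (hk : 0 < k) (hpk : 0 < p * k - 1) :
    -- the given triple is the unique constant solution, and it is positive
    (∀ x₀ l₀ w₀ : ℝ,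
      IsTangleSolution (fun _ => β) h p k (fun _ => x₀) (fun _ => l₀) (fun _ => w₀) ↔
        x₀ = xEq β h p k ∧ l₀ = lEq β h p k ∧ w₀ = wEq β h p k) ∧
    0 < xEq β h p k ∧ 0 < lEq β h p k ∧ 0 < wEq β h p k ∧
    -- every solution of the linearised system tends to zero
    IsLinearlyStable β h p k (xEq β h p k) (lEq β h p k) ∧
    -- the spectrum is given by the characteristic equation and has negative real parts
    (∀ z : ℂ, z ∈ linearizedSpectrum β h p k (xEq β h p k) (lEq β h p k) ↔
      ((p * k : ℝ) : ℂ) + ((p * k / (p * k - 1) : ℝ) : ℂ) * (h * z) = Complex.exp (-(h * z))) ∧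
    (∀ z ∈ linearizedSpectrum β h p k (xEq β h p k) (lEq β h p k), z.re < 0) ∧
    -- the equilibrium of the nonlinear system is locally asymptotically stable
    IsLocallyAsymptoticallyStable (fun _ => β) h p k
      (xEq β h p k) (lEq β h p k) (wEq β h p k) := by
  refine ⟨isTangleSolution_const_iff hβ hh hpk, xEq_pos hβ hh hpk, lEq_pos hβ hh hpk, ?_,
    isLinearlyStable_eq hβ hh hpk, mem_linearizedSpectrum_iff hβ hh hpk, fun z hz => ?_,
    isLocallyAsymptoticallyStable_eq hβ hh hpk⟩
  · rw [wEq_eq hpk]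
    exact mul_pos hh hβ
  · exact re_neg_of_characteristic hh hpk ((mem_linearizedSpectrum_iff hβ hh hpk z).1 hz)
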